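/- Modal formulas over a countably infinite set of variables $\mathcal V$ are built from literals $p,\neg p$ ($p\in\mathcal V$) and $\bot,\top$ by $\wedge,\vee,\Diamond,\Box$; negation of an arbitrary formula is defined by the duality laws, $\varphi\to\psi$ is $\neg\varphi\vee\psi$, and $\varphi\leftrightarrow\psi$ is $(\varphi\to\psi)\wedge(\psi\to\varphi)$. Write $\mathrm{lits}(\varphi)$ and $\mathrm{vars}(\varphi)$ for the sets of literals and of variables occurring in $\varphi$ (so $\mathrm{lits}(\neg p)=\{\neg p\}$ and $\mathrm{vars}(\neg p)=\{p\}$). A formula is closed if it contains no variables, and positive if it contains no negated variable. A modal logic is a set of formulas that contains all classical tautologies and is closed under modus ponens, substitution, and the rule: from $\varphi\leftrightarrow\psi$ infer $\Diamond\varphi\leftrightarrow\Diamond\psi$. For a logic $\Lambda$ and a set of formulas $\Gamma$, $\Lambda+\Gamma$ is the smallest modal logic containing $\Lambda\cup\Gamma$. Let $\mathrm E$ be the smallest modal logic and $\mathrm{EM}=\mathrm E+\{\Diamond p\to\Diamond(p\vee q)\}$ the smallest monotone modal logic. A logic $\Lambda$ has the Lyndon interpolation property (LIP) if whenever $\varphi\to\psi\in\Lambda$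 there is a formula $\iota$ with $\mathrm{lits}(\iota)\subseteq\mathrm{lits}(\varphi)\cap\mathrm{lits}(\psi)$ and $\varphi\to\iota,\ \iota\to\psi\in\Lambda$. It has the Lyndon positivity property (LPP) if for all finite tuples $\vec p,\bar r$ of pairwise distinct variables and every formula $\varphi(\vec p,\bar r)$ with variables among $\vec p,\bar r$ such that $\varphi(\vec p,\bar r)\to\varphi(\vec p\vee\vec q,\bar r)\in\Lambda$, where $\vec q$ is a tuple of pairwise distinct variables, of the same length as $\vec p$ and not occurring in $\vec p,\bar r$, and $\vec p\vee\vec q=(p_i\vee q_i)_i$, there is a formula $\alpha(\vec p,\bar r)$ with variables among $\vec p,\bar r$, containing none of the literals $\neg p_i$, such that $\varphi\leftrightarrow\alpha\in\Lambda$. **Corollary.** Let $\Lambda=\mathrm{EM}+\Gamma$, where $\Gamma$ is any set of formulas each of which is either closed or of the form $\alpha(p)\to\Diamond p$ for some variable $p$ and some positive formula $\alpha$ with $\mathrm{vars}(\alpha)\subseteq\{p\}$. Then $\Lambda$ has both LIP and LPP. -/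

import Mathlib

namespace MonModal

/-- Literals over the countable set `ℕ` of propositional variables. -/
inductive Literal : Type
  | pos (p : ℕ) : Literal
  | neg (p : ℕ) : Literal

/-- The opposite literal. -/
def Literal.compl : Literal → Literal
  | .pos p => .neg p
  | .neg p => .pos p

/-- The variable of a literal. -/
def Literal.var : Literal → ℕ
  | .pos p => p
  | .neg p => p

/-- Modal formulas in negation normal form. -/
inductive Formula : Type
  | lit (l : Literal) : Formula
  | bot : Formula
  | top : Formula
  | and (φ ψ : Formula) : Formula
  | or (φ ψ : Formula) : Formula
  | dia (φ : Formula) : Formula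
  | box (φ : Formula) : Formula

namespace Formula

/-- The variable `p` as a formula. -/
def var (p : ℕ) : Formula := lit (.pos p)

/-- Negation, given by the duality laws. -/
def neg : Formula → Formula
  | lit l => lit l.compl
  | bot => top
  | top => bot
  | and φ ψ => or φ.neg ψ.neg
  | or φ ψ => and φ.neg ψ.neg
  | dia φ => box φ.neg
  | box φ => dia φ.neg

/-- Implication `φ → ψ`. -/
def imp (φ ψ : Formula) : Formula := or φ.neg ψ

/-- Equivalence `φ ↔ ψ`. -/
def iff (φ ψ : Formula) : Formula := and (imp φ ψ) (imp ψ φ)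

/-- The set of literals occurring in a formula. -/
def lits : Formula → Set Literal
  | lit l => {l}
  | bot => ∅
  | top => ∅
  | and φ ψ => φ.lits ∪ ψ.lits
  | or φ ψ => φ.lits ∪ ψ.lits
  | dia φ => φ.lits
  | box φ => φ.lits

/-- The set of variables occurring in a formula (positively or under a negation). -/
def vars (φ : Formula) : Set ℕ := Literal.var '' φ.lits

/-- Simultaneous substitution of `σ p` for every variable `p`; a negated variable `¬p` is replaced
by the (expanded) negation of `σ p`. -/
def subst (σ : ℕ → Formula) : Formula → Formula
  | lit (.pos p) => σ p
  | lit (.neg p) => (σ p).neg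
  | bot => bot
  | top => top
  | and φ ψ => and (φ.subst σ) (ψ.subst σ)
  | or φ ψ => or (φ.subst σ) (ψ.subst σ)
  | dia φ => dia (φ.subst σ)
  | box φ => box (φ.subst σ)

/-- A closed formula contains no variables. -/
def IsClosed (φ : Formula) : Prop := φ.vars = ∅

/-- `φ` is `P`-positive: it contains no negation of a variable from `P`. -/
def IsPositiveIn (P : Set ℕ) (φ : Formula) : Prop := ∀ p ∈ P, Literal.neg p ∉ φ.lits

/-- A positive formula contains no negation of a variable. -/
def IsPositive (φ : Formula) : Prop := ∀ p, Literal.neg p ∉ φ.lits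

/-- Classical truth value of a formula whose modal subformulas are treated as atoms: `v` gives the
values of the variables and `d ψ` the value of `◇ψ`. As `□ψ` is the negation of `◇¬ψ`, its value is
determined by `d` too. -/
def eval (v : ℕ → Prop) (d : Formula → Prop) : Formula → Prop
  | lit (.pos p) => v p
  | lit (.neg p) => ¬ v p
  | bot => False
  | top => True
  | and φ ψ => φ.eval v d ∧ ψ.eval v d
  | or φ ψ => φ.eval v d ∨ ψ.eval v d
  | dia φ => d φ
  | box φ => ¬ d φ.neg

/-- Classical tautologies in the modal language. -/
def IsTautology (φ : Formula) : Prop := ∀ v d, φ.eval v d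

end Formula

open Formula

/-- Modal logics: sets of formulas that contain all classical tautologies and are closed under modus
ponens, substitution and equivalent replacement. -/
structure IsLogic (L : Set Formula) : Prop where
  taut : ∀ φ, φ.IsTautology → φ ∈ L
  mp : ∀ φ ψ, imp φ ψ ∈ L → φ ∈ L → ψ ∈ L
  subst : ∀ (σ : ℕ → Formula) φ, φ ∈ L → φ.subst σ ∈ L
  repl : ∀ φ ψ, iff φ ψ ∈ L → iff (dia φ) (dia ψ) ∈ L

/-- `ext L Γ` is the logic `L + Γ`, the smallest logic containing `L ∪ Γ`. -/
def ext (L Γ : Set Formula) : Set Formula := ⋂₀ {M | IsLogic M ∧ L ∪ Γ ⊆ M}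

/-- The least modal logic `E`. -/
def logicE : Set Formula := ⋂₀ {M | IsLogic M}

/-- The axiom `◇p → ◇(p ∨ q)`. -/
def axiomM : Formula := imp (dia (var 0)) (dia (or (var 0) (var 1)))

/-- The minimal monotone modal logic `EM = E + {◇p → ◇(p ∨ q)}`. -/
def logicEM : Set Formula := ext logicE {axiomM}

/-- The Lyndon interpolation property. -/
def LIP (L : Set Formula) : Prop :=
  ∀ φ ψ : Formula, imp φ ψ ∈ L →
    ∃ ι : Formula, ι.lits ⊆ φ.lits ∩ ψ.lits ∧ imp φ ι ∈ L ∧ imp ι ψ ∈ L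

/-- The substitution that replaces each variable `p ∈ P` by `p ∨ q p`. -/
def joinSubst (P : Finset ℕ) (q : ℕ → ℕ) (x : ℕ) : Formula :=
  if x ∈ P then or (var x) (var (q x)) else var x

/-- For disjoint finite sets (tuples) of variables `P` and `R` and a formula `φ(P, R)`: `φ` is
`P`-monotone in `L`, that is, `φ(P, R) → φ(P ∨ q, R)` is in `L`, where `q` is a tuple of pairwise
distinct variables, indexed by `P`, outside `P` and `R`. By closure under substitution, the choice
of `q` does not matter for a logic `L`. -/
def IsMonotoneIn (L : Set Formula) (P R : Finset ℕ) (φ : Formula) : Prop :=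
  ∃ q : ℕ → ℕ, Set.InjOn q P ∧ (∀ p ∈ P, q p ∉ P ∪ R) ∧ imp φ (φ.subst (joinSubst P q)) ∈ L

/-- The Lyndon positivity property (with parameters): every formula `φ(P, R)` that is `P`-monotone
in `L` is `L`-equivalent to a `P`-positive formula `α(P, R)`. -/
def LPP (L : Set Formula) : Prop :=
  ∀ (P R : Finset ℕ), Disjoint P R →
    ∀ φ : Formula, φ.vars ⊆ ↑(P ∪ R) → IsMonotoneIn L P R φ →
      ∃ α : Formula, α.vars ⊆ ↑(P ∪ R) ∧ α.IsPositiveIn P ∧ iff φ α ∈ L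

end MonModal

namespace MonModal

/-! ### Negation, substitution and truth values -/

namespace Formula

/-! Fix a set `K` of literals. The worlds are pairs `(x, y)` of complete theories such that every
formula over `K` in `x` lies in `y`; by a compactness-style argument, either `φ → ψ` has an
interpolant over `K` or some pair has `φ ∈ x`, `ψ ∉ y`. One neighbourhood function serves both
components: with the canonical valuation of either one, truth is membership in that component
(`mem_sat_pairVal_iff`). This rests on `dia_mem_of_forall_pair`, where modal formulas pass between
components through an interpolant.

The neighbourhood function is chosen as large as possible, so the frame validates the axioms `α(p) →
◇p`, and hence all of `L`, under arbitrary valuations. For LIP and LPP, a pair refuting the desired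
formula then yields a contradiction by evaluating the given theorem of `L` under a valuation that
mixes the two canonical ones. -/

@[simp] theorem neg_neg (φ : Formula) : φ.neg.neg = φ := by
  induction φ with
  | lit l => cases l <;> rfl
  | _ => simp_all [neg]

@[simp] theorem subst_var (φ : Formula) : φ.subst var = φ := by
  induction φ with
  | lit l => cases l <;> rfl
  | _ => simp_all [subst]

theorem eval_neg (v : ℕ → Prop) (d : Formula → Prop) (φ : Formula) :
    φ.neg.eval v d ↔ ¬ φ.eval v d := by
  induction φ with
  | lit l => cases l <;> simp [neg, Literal.compl, eval]
  | and φ ψ hφ hψ => simp only [neg, eval, hφ, hψ]; tauto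
  | or φ ψ hφ hψ => simp only [neg, eval, hφ, hψ]; tauto
  | _ => simp [neg, eval]

theorem eval_imp (v : ℕ → Prop) (d : Formula → Prop) (φ ψ : Formula) :
    (imp φ ψ).eval v d ↔ (φ.eval v d → ψ.eval v d) := by
  simp only [imp, eval, eval_neg]; tauto

theorem eval_iff (v : ℕ → Prop) (d : Formula → Prop) (φ ψ : Formula) :
    (iff φ ψ).eval v d ↔ (φ.eval v d ↔ ψ.eval v d) := by
  simp only [iff, eval, eval_imp]; tauto

theorem neg_subst (σ : ℕ → Formula) (φ : Formula) : φ.neg.subst σ = (φ.subst σ).neg := by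
  induction φ with
  | lit l => cases l <;> simp [neg, Literal.compl, subst]
  | _ => simp_all [neg, subst]

theorem imp_subst (σ : ℕ → Formula) (φ ψ : Formula) :
    (imp φ ψ).subst σ = imp (φ.subst σ) (ψ.subst σ) := by
  simp [imp, subst, neg_subst]

theorem eq_pos_of_mem_lits {φ : Formula} {p : ℕ} (hpos : φ.IsPositive) (hv : φ.vars ⊆ {p})
    {l : Literal} (hl : l ∈ φ.lits) : l = .pos p := by
  have h : l.var = p := hv ⟨l, hl, rfl⟩
  cases l with
  | pos q => simpa [Literal.var] using h
  | neg q => exact absurd hl (hpos q)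

end Formula

open Formula

/-! ### Theories, Lindenbaum's lemma and separating pairs -/

section Theories

/-- Sets of formulas containing the classical tautologies and closed under modus ponens. -/
structure IsTheory (T : Set Formula) : Prop where
  taut : ∀ φ, φ.IsTautology → φ ∈ T
  mp : ∀ φ ψ, imp φ ψ ∈ T → φ ∈ T → ψ ∈ T

theorem IsLogic.isTheory {L : Set Formula} (hL : IsLogic L) : IsTheory L := ⟨hL.taut, hL.mp⟩

namespace IsTheory

variable {T : Set Formula}

theorem of_eval (hT : IsTheory T) {φ ψ : Formula} (hφ : φ ∈ T)
    (h : ∀ v d, φ.eval v d → ψ.eval v d) : ψ ∈ T :=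
  hT.mp _ _ (hT.taut _ fun v d => (eval_imp v d _ _).2 (h v d)) hφ

theorem of_eval₂ (hT : IsTheory T) {φ ψ χ : Formula} (hφ : φ ∈ T) (hψ : ψ ∈ T)
    (h : ∀ v d, φ.eval v d → ψ.eval v d → χ.eval v d) : χ ∈ T := by
  refine hT.mp _ _ (hT.of_eval hφ fun v d h' => ?_) hψ
  exact (eval_imp v d _ _).2 (h v d h')

theorem iff_of_imp (hT : IsTheory T) {φ ψ : Formula} (h₁ : imp φ ψ ∈ T) (h₂ : imp ψ φ ∈ T) :
    iff φ ψ ∈ T :=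
  hT.of_eval₂ h₁ h₂ fun v d => by simp only [eval_imp, eval_iff]; tauto

theorem adjoin (hT : IsTheory T) (θ : Formula) : IsTheory {η | imp θ η ∈ T} where
  taut φ h := hT.taut _ fun v d => (eval_imp v d _ _).2 fun _ => h v d
  mp φ ψ h₁ h₂ := hT.of_eval₂ h₁ h₂ fun v d => by simp only [eval_imp]; tauto

theorem sUnion {c : Set (Set Formula)} (hc : IsChain (· ⊆ ·) c) (hne : c.Nonempty)
    (h : ∀ T ∈ c, IsTheory T) : IsTheory (⋃₀ c) where
  taut φ hφ := let ⟨T, hT⟩ := hne; ⟨T, hT, (h T hT).taut φ hφ⟩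
  mp φ ψ := by
    rintro ⟨T, hT, h₁⟩ ⟨T', hT', h₂⟩
    rcases hc.total hT hT' with hs | hs
    · exact ⟨T', hT', (h T' hT').mp _ _ (hs h₁) h₂⟩
    · exact ⟨T, hT, (h T hT).mp _ _ h₁ (hs h₂)⟩

end IsTheory

/-- Complete consistent theories that extend `L`. -/
structure IsComplete (L x : Set Formula) : Prop extends IsTheory x where
  subset : L ⊆ x
  neg_mem_iff : ∀ φ, φ.neg ∈ x ↔ φ ∉ x

namespace IsComplete

variable {L x : Set Formula}

theorem of_imp (hx : IsComplete L x) {φ ψ : Formula} (h : imp φ ψ ∈ L) (hφ : φ ∈ x) : ψ ∈ x :=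
  hx.mp _ _ (hx.subset h) hφ

theorem and_mem (hx : IsComplete L x) {φ ψ : Formula} (hφ : φ ∈ x) (hψ : ψ ∈ x) :
    and φ ψ ∈ x :=
  hx.of_eval₂ hφ hψ fun _ _ h₁ h₂ => ⟨h₁, h₂⟩

end IsComplete

/-- Lindenbaum's lemma. -/
theorem IsTheory.exists_isComplete {L T : Set Formula} (hT : IsTheory T) (hLT : L ⊆ T)
    {χ : Formula} (hχ : χ ∉ T) : ∃ x, IsComplete L x ∧ T ⊆ x ∧ χ ∉ x := by
  obtain ⟨x, hTx, hx⟩ := zorn_subset_nonempty {F | IsTheory F ∧ χ ∉ F}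
    (fun c hc hchain hne => ⟨⋃₀ c, ⟨IsTheory.sUnion hchain hne fun F hF => (hc hF).1,
      fun ⟨F, hF, h⟩ => (hc hF).2 h⟩, fun F hF => Set.subset_sUnion_of_mem hF⟩) T ⟨hT, hχ⟩
  have hth : IsTheory x := hx.prop.1
  -- By maximality, adjoining any `θ` outside `x` must derive `χ`.
  have key (θ : Formula) (hθ : θ ∉ x) : imp θ χ ∈ x := by
    by_contra h
    have hsub : x ⊆ {η | imp θ η ∈ x} := fun η hη =>
      hth.of_eval hη fun v d => by simp only [eval_imp]; tauto
    refine hθ (hx.le_of_ge ⟨hth.adjoin θ, h⟩ hsub ?_)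
    exact hth.taut _ fun v d => (eval_imp v d _ _).2 id
  refine ⟨x, ⟨hth, hLT.trans hTx, fun φ => ⟨fun h h' => hx.prop.2 ?_, fun h => ?_⟩⟩, hTx,
    hx.prop.2⟩
  · exact hth.of_eval₂ h h' fun v d => by simp only [eval_neg]; tauto
  · by_contra h'
    exact hx.prop.2 (hth.of_eval₂ (key _ h) (key _ h') fun v d => by
      simp only [eval_imp, eval_neg]; tauto)

theorem IsTheory.exists_isComplete_of_imp_notMem {L : Set Formula} (hL : IsTheory L)
    {φ ψ : Formula} (h : imp φ ψ ∉ L) : ∃ x, IsComplete L x ∧ φ ∈ x ∧ ψ ∉ x := by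
  obtain ⟨x, hx, hsub, hψ⟩ := (hL.adjoin φ).exists_isComplete (L := L)
    (fun η hη => hL.of_eval hη fun v d => by simp only [eval_imp]; tauto) h
  exact ⟨x, hx, hsub (hL.taut _ fun v d => (eval_imp v d _ _).2 id), hψ⟩

/-- If no formula with literals in `K` interpolates `φ → ψ`, then `φ` and `ψ` are separated by a
pair of complete theories along which formulas with literals in `K` are preserved. -/
theorem IsTheory.exists_isComplete_pair {L : Set Formula} (hL : IsTheory L) {K : Set Literal}
    {φ ψ : Formula} (h : ¬ ∃ ι : Formula, ι.lits ⊆ K ∧ imp φ ι ∈ L ∧ imp ι ψ ∈ L) :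
    ∃ x y, IsComplete L x ∧ IsComplete L y ∧ (∀ κ : Formula, κ.lits ⊆ K → κ ∈ x → κ ∈ y) ∧
      φ ∈ x ∧ ψ ∉ y := by
  -- The consequences over `L` of `φ` and of all `¬ι` with `ι` over `K` and `ι → ψ` in `L`; an
  -- inconsistency here would be an interpolant.
  have hF : IsTheory {η | ∃ ι : Formula, ι.lits ⊆ K ∧ imp ι ψ ∈ L ∧ imp φ (or ι η) ∈ L} := by
    constructor
    · intro η hη
      refine ⟨bot, by simp [lits], hL.taut _ fun v d => ?_, hL.taut _ fun v d => ?_⟩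
      · simp [eval_imp, eval]
      · simp [eval_imp, eval, hη v d]
    · rintro η θ ⟨ι, hι, h₁, h₂⟩ ⟨κ, hκ, h₃, h₄⟩
      refine ⟨or ι κ, Set.union_subset hι hκ, hL.of_eval₂ h₁ h₃ fun v d => ?_,
        hL.of_eval₂ h₂ h₄ fun v d => ?_⟩
      · simp only [eval_imp, eval]; tauto
      · simp only [eval_imp, eval]; tauto
  obtain ⟨x, hx, hFx, -⟩ := hF.exists_isComplete (L := L) (χ := bot)
    (fun η hη => ⟨bot, by simp [lits], hL.taut _ fun v d => by simp [eval_imp, eval],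
      hL.of_eval hη fun v d => by simp only [eval_imp, eval]; tauto⟩)
    (fun ⟨ι, hι, h₁, h₂⟩ => h ⟨ι, hι, hL.of_eval h₂ fun v d => by
      simp only [eval_imp, eval]; tauto, h₁⟩)
  have hφ : φ ∈ x := hFx ⟨bot, by simp [lits], hL.taut _ fun v d => by simp [eval_imp, eval],
    hL.taut _ fun v d => by simp only [eval_imp, eval]; tauto⟩
  -- The consequences of the `K`-part of `x`. It omits `ψ`: if `κ ∈ x` over `K` implied `ψ`, then
  -- `¬κ` would already be in `x`.
  have hG : IsTheory {η | ∃ κ : Formula, κ.lits ⊆ K ∧ κ ∈ x ∧ imp κ η ∈ L} := by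
    constructor
    · intro η hη
      exact ⟨top, by simp [lits], hx.taut _ fun _ _ => trivial, hL.taut _ fun v d => by
        simp [eval_imp, hη v d]⟩
    · rintro η θ ⟨ι, hι, h₁, h₂⟩ ⟨κ, hκ, h₃, h₄⟩
      refine ⟨and ι κ, Set.union_subset hι hκ, hx.and_mem h₁ h₃,
        hL.of_eval₂ h₂ h₄ fun v d => ?_⟩
      simp only [eval_imp, eval]; tauto
  obtain ⟨y, hy, hGy, hψ⟩ := hG.exists_isComplete (L := L) (χ := ψ)
    (fun η hη => ⟨top, by simp [lits], hx.taut _ fun _ _ => trivial,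
      hL.of_eval hη fun v d => by simp only [eval_imp]; tauto⟩) (by
      rintro ⟨κ, hκ, hκx, hκψ⟩
      refine (hx.neg_mem_iff κ).1 (hFx ⟨κ, hκ, hκψ, hL.taut _ fun v d => ?_⟩) hκx
      simp only [eval_imp, eval, eval_neg]; tauto)
  exact ⟨x, y, hx, hy, fun κ hκ hκx => hGy ⟨κ, hκ, hκx, hL.taut _ fun v d =>
    (eval_imp v d _ _).2 id⟩, hφ, hψ⟩

end Theories

/-! ### Neighbourhood semantics -/

section Semantics

variable {W : Type*}

/-- The truth set of a formula in the neighbourhood frame `N` under the valuation `V`. -/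
def sat (N : W → Set (Set W)) (V : ℕ → Set W) : Formula → Set W
  | .lit (.pos p) => V p
  | .lit (.neg p) => (V p)ᶜ
  | .bot => ∅
  | .top => Set.univ
  | .and φ ψ => sat N V φ ∩ sat N V ψ
  | .or φ ψ => sat N V φ ∪ sat N V ψ
  | .dia φ => {w | sat N V φ ∈ N w}
  | .box φ => {w | (sat N V φ)ᶜ ∉ N w}

variable (N : W → Set (Set W)) (V : ℕ → Set W)

theorem sat_neg (φ : Formula) : sat N V φ.neg = (sat N V φ)ᶜ := by
  induction φ with
  | lit l => cases l <;> simp [neg, Literal.compl, sat]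
  | and φ ψ hφ hψ => simp [neg, sat, hφ, hψ, Set.compl_inter]
  | or φ ψ hφ hψ => simp [neg, sat, hφ, hψ, Set.compl_union]
  | bot => simp [neg, sat]
  | top => simp [neg, sat]
  | dia φ hφ => ext w; simp [neg, sat, hφ]
  | box φ hφ => ext w; simp [neg, sat, hφ]

theorem mem_sat_imp {φ ψ : Formula} {w : W} :
    w ∈ sat N V (imp φ ψ) ↔ (w ∈ sat N V φ → w ∈ sat N V ψ) := by
  simp only [imp, sat, sat_neg, Set.mem_union, Set.mem_compl_iff]; tauto

theorem mem_sat_iff {φ ψ : Formula} {w : W} :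
    w ∈ sat N V (iff φ ψ) ↔ (w ∈ sat N V φ ↔ w ∈ sat N V ψ) := by
  simp only [Formula.iff, sat, Set.mem_inter_iff, mem_sat_imp]; tauto

theorem sat_subst (σ : ℕ → Formula) (φ : Formula) :
    sat N V (φ.subst σ) = sat N (fun p => sat N V (σ p)) φ := by
  induction φ with
  | lit l => cases l <;> simp [subst, sat, sat_neg]
  | _ => simp_all [subst, sat]

theorem mem_sat_iff_eval (φ : Formula) (w : W) :
    w ∈ sat N V φ ↔ φ.eval (fun p => w ∈ V p) (fun ψ => sat N V ψ ∈ N w) := by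
  induction φ with
  | lit l => cases l <;> simp [sat, eval]
  | dia φ => rfl
  | box φ => simp [sat, eval, sat_neg]
  | _ => simp_all [sat, eval]

theorem isLogic_valid : IsLogic {φ | ∀ V w, w ∈ sat N V φ} where
  taut φ h V w := (mem_sat_iff_eval N V φ w).2 (h _ _)
  mp φ ψ h₁ h₂ V w := (mem_sat_imp N V).1 (h₁ V w) (h₂ V w)
  subst σ φ h V w := by rw [sat_subst]; exact h _ w
  repl φ ψ h V w := by
    have : sat N V φ = sat N V ψ := Set.ext fun u => (mem_sat_iff N V).1 (h V u)
    simp [mem_sat_iff, sat, this]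

variable {N V}

/-- In negation normal form every connective is monotone, so the valuations need comparing only on
the literals that actually occur. -/
theorem sat_mono (hN : ∀ w U U', U ∈ N w → U ⊆ U' → U' ∈ N w) {V' : ℕ → Set W} {φ : Formula}
    (h : ∀ l ∈ φ.lits, sat N V (.lit l) ⊆ sat N V' (.lit l)) : sat N V φ ⊆ sat N V' φ := by
  induction φ with
  | lit l => exact h l rfl
  | bot => exact subset_rfl
  | top => exact subset_rfl
  | and φ ψ hφ hψ =>
    exact Set.inter_subset_inter (hφ fun l hl => h l (.inl hl))
        (hψ fun l hl => h l (.inr hl))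
  | or φ ψ hφ hψ =>
    exact Set.union_subset_union (hφ fun l hl => h l (.inl hl))
        (hψ fun l hl => h l (.inr hl))
  | dia φ hφ => exact fun w hw => hN w _ _ hw (hφ h)
  | box φ hφ => exact fun w hw hw' => hw (hN w _ _ hw' (Set.compl_subset_compl.2 (hφ h)))

theorem sat_congr (hN : ∀ w U U', U ∈ N w → U ⊆ U' → U' ∈ N w) {V' : ℕ → Set W} {φ : Formula}
    (h : ∀ p ∈ φ.vars, V p = V' p) : sat N V φ = sat N V' φ := by
  have key : ∀ l ∈ φ.lits, sat N V (.lit l) = sat N V' (.lit l) := by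
    rintro (p | p) hl <;> simp [sat, h p ⟨_, hl, rfl⟩]
  exact (sat_mono hN fun l hl => (key l hl).subset).antisymm
    (sat_mono hN fun l hl => (key l hl).superset)

end Semantics

/-! ### Extensions of logics and monotonicity of `◇` -/

section Logics

theorem isLogic_ext (L Γ : Set Formula) : IsLogic (ext L Γ) where
  taut φ h _ hM := hM.1.taut φ h
  mp φ ψ h₁ h₂ M hM := hM.1.mp φ ψ (h₁ M hM) (h₂ M hM)
  subst σ φ h M hM := hM.1.subst σ φ (h M hM)
  repl φ ψ h M hM := hM.1.repl φ ψ (h M hM)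

theorem subset_ext_left (L Γ : Set Formula) : L ⊆ ext L Γ :=
  fun _ h _ hM => hM.2 (.inl h)

theorem subset_ext_right (L Γ : Set Formula) : Γ ⊆ ext L Γ :=
  fun _ h _ hM => hM.2 (.inr h)

theorem ext_subset {L Γ M : Set Formula} (hM : IsLogic M) (hL : L ⊆ M) (hΓ : Γ ⊆ M) :
    ext L Γ ⊆ M :=
  fun _ h => h M ⟨hM, Set.union_subset hL hΓ⟩

theorem IsLogic.dia_mono {L : Set Formula} (hL : IsLogic L) (hM : logicEM ⊆ L) {φ ψ : Formula}
    (h : imp φ ψ ∈ L) : imp (dia φ) (dia ψ) ∈ L := by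
  have h₁ := hL.subst (fun n => if n = 0 then φ else ψ) _
    (hM (subset_ext_right logicE {axiomM} rfl))
  simp only [axiomM, imp_subst, Formula.subst, var, if_true, one_ne_zero, if_false] at h₁
  have h₂ : iff (or φ ψ) ψ ∈ L := hL.isTheory.of_eval h fun v d => by
    simp only [eval_iff, eval_imp, eval]; tauto
  exact hL.isTheory.of_eval₂ h₁ (hL.repl _ _ h₂) fun v d => by
    simp only [eval_iff, eval_imp, eval]; tauto

end Logics

/-! ### The frame of pairs and its validity -/

section PairFrame

/-- Pairs of complete theories along which formulas with literals in `K` are preserved. -/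
def Pair (L : Set Formula) (K : Set Literal) : Type :=
  {w : Bool → Set Formula // (∀ s, IsComplete L (w s)) ∧
    ∀ κ : Formula, κ.lits ⊆ K → κ ∈ w false → κ ∈ w true}

/-- The greatest neighbourhood function on pairs for which every neighbourhood contained in the set
of pairs with `χ` in one component forces `◇χ` into that component. -/
def pairNhd (L : Set Formula) (K : Set Literal) (w : Pair L K) : Set (Set (Pair L K)) :=
  {U | ∀ (s : Bool) (χ : Formula), (∀ u ∈ U, χ ∈ u.1 s) → dia χ ∈ w.1 s}

/-- The canonical valuation in the component `s`. -/
def pairVal (L : Set Formula) (K : Set Literal) (s : Bool) (p : ℕ) : Set (Pair L K) :=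
  {w | var p ∈ w.1 s}

variable {L : Set Formula} {K : Set Literal}

theorem pairNhd_mono (w : Pair L K) (U U' : Set (Pair L K)) (hU : U ∈ pairNhd L K w)
    (h : U ⊆ U') : U' ∈ pairNhd L K w :=
  fun s χ hχ => hU s χ fun u hu => hχ u (h hu)

theorem exists_interpolant_or_pair (hL : IsLogic L) (φ ψ : Formula) :
    (∃ ι : Formula, ι.lits ⊆ K ∧ imp φ ι ∈ L ∧ imp ι ψ ∈ L) ∨
      ∃ w : Pair L K, φ ∈ w.1 false ∧ ψ ∉ w.1 true := by
  by_cases h : ∃ ι : Formula, ι.lits ⊆ K ∧ imp φ ι ∈ L ∧ imp ι ψ ∈ L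
  · exact .inl h
  · obtain ⟨x, y, hx, hy, hxy, hφ, hψ⟩ := hL.isTheory.exists_isComplete_pair h
    exact .inr ⟨⟨fun s => cond s y x, by rintro (_ | _) <;> assumption, hxy⟩, hφ, hψ⟩

/-- Every complete theory occurs in either component, through the diagonal pair `(x, x)`. -/
theorem imp_mem_of_forall_pair (hL : IsLogic L) {s : Bool} {θ χ : Formula}
    (h : ∀ u : Pair L K, θ ∈ u.1 s → χ ∈ u.1 s) : imp θ χ ∈ L := by
  by_contra hn
  obtain ⟨x, hx, hθ, hχ⟩ := hL.isTheory.exists_isComplete_of_imp_notMem hn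
  exact hχ (h ⟨fun _ => x, fun _ => hx, fun _ _ => id⟩ hθ)

/-- Across components, the hypothesis excludes a separating pair, so there is an interpolant `ι`
over `K`; `◇ι` is again over `K` and carries the diamond across. -/
theorem dia_mem_of_forall_pair (hL : IsLogic L) (hM : logicEM ⊆ L) {s t : Bool} {θ χ : Formula}
    (h : ∀ u : Pair L K, θ ∈ u.1 s → χ ∈ u.1 t) (w : Pair L K) (hw : dia θ ∈ w.1 s) :
    dia χ ∈ w.1 t := by
  have same (s : Bool) (h : ∀ u : Pair L K, θ ∈ u.1 s → χ ∈ u.1 s) (hw : dia θ ∈ w.1 s) :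
      dia χ ∈ w.1 s :=
    (w.2.1 s).of_imp (hL.dia_mono hM (imp_mem_of_forall_pair hL h)) hw
  cases s <;> cases t
  · exact same _ h hw
  · rcases exists_interpolant_or_pair (K := K) hL θ χ with ⟨ι, hι, h₁, h₂⟩ | ⟨u, h₁, h₂⟩
    · exact (w.2.1 true).of_imp (hL.dia_mono hM h₂)
        (w.2.2 (dia ι) hι ((w.2.1 false).of_imp (hL.dia_mono hM h₁) hw))
    · exact absurd (h u h₁) h₂
  -- Formulas over `K` move only from `false` to `true`, so this direction is contraposed: `□ι`, the
  -- dual of `◇¬ι`, is what gets carried.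
  · rcases exists_interpolant_or_pair (K := K) hL χ.neg θ.neg with
      ⟨ι, hι, h₁, h₂⟩ | ⟨u, h₁, h₂⟩
    · have h₁' : imp ι.neg χ ∈ L := hL.isTheory.of_eval h₁ fun v d => by
        simp only [eval_imp, eval_neg]; tauto
      have h₂' : imp θ ι.neg ∈ L := hL.isTheory.of_eval h₂ fun v d => by
        simp only [eval_imp, eval_neg]; tauto
      refine (w.2.1 false).of_imp (hL.dia_mono hM h₁') ?_
      by_contra hn
      have hbox := ((w.2.1 false).neg_mem_iff _).2 hn
      have hbox' := w.2.2 _ (by simpa [neg, lits] using hι) hbox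
      exact ((w.2.1 true).neg_mem_iff _).1 hbox' ((w.2.1 true).of_imp (hL.dia_mono hM h₂') hw)
    · refine absurd (h u ?_) (((u.2.1 false).neg_mem_iff χ).1 h₁)
      by_contra hn
      exact h₂ (((u.2.1 true).neg_mem_iff θ).2 hn)
  · exact same _ h hw

/-- Substitution instances of formulas are bounded from below by their truth sets, provided that
this holds for their literals. -/
theorem subst_mem_of_mem_sat (hL : IsLogic L) (hM : logicEM ⊆ L) {s : Bool}
    {V : ℕ → Set (Pair L K)} {σ : ℕ → Formula} {β : Formula}
    (h : ∀ l ∈ β.lits, ∀ w ∈ sat (pairNhd L K) V (.lit l), (lit l).subst σ ∈ w.1 s) :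
    ∀ w ∈ sat (pairNhd L K) V β, β.subst σ ∈ w.1 s := by
  induction β with
  | lit l => exact h l rfl
  | bot => exact fun w hw => hw.elim
  | top => exact fun w _ => (w.2.1 s).taut _ fun _ _ => trivial
  | and φ ψ hφ hψ =>
    exact fun w hw => (w.2.1 s).and_mem (hφ (fun l hl => h l (.inl hl)) w hw.1)
        (hψ (fun l hl => h l (.inr hl)) w hw.2)
  | or φ ψ hφ hψ =>
    rintro w (hw | hw)
    · exact (w.2.1 s).of_eval (hφ (fun l hl => h l (.inl hl)) w hw) fun _ _ => .inl
    · exact (w.2.1 s).of_eval (hψ (fun l hl => h l (.inr hl)) w hw) fun _ _ => .inr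
  | dia φ hφ => exact fun w hw => hw s _ (hφ h)
  | box φ hφ =>
    intro w hw
    by_contra hn
    have hdia := ((w.2.1 s).neg_mem_iff _).2 hn
    -- If `□φ` fails in component `s`, the complement of the truth set of `φ` is a neighbourhood: it
    -- contains all pairs with `¬φσ` in component `s`, and `◇¬φσ` holds there.
    refine hw fun t χ hχ => dia_mem_of_forall_pair hL hM (fun u hu => hχ u fun hu' => ?_) w hdia
    exact ((u.2.1 s).neg_mem_iff _).1 hu (hφ h u hu')

/-- The lower bound with the identity substitution gives one direction; applied to `¬φ` it gives the
other. -/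
theorem mem_sat_pairVal_iff (hL : IsLogic L) (hM : logicEM ⊆ L) (s : Bool) (φ : Formula)
    (w : Pair L K) : w ∈ sat (pairNhd L K) (pairVal L K s) φ ↔ φ ∈ w.1 s := by
  have key (ψ : Formula) (h : w ∈ sat (pairNhd L K) (pairVal L K s) ψ) : ψ ∈ w.1 s := by
    rw [← subst_var ψ]
    refine subst_mem_of_mem_sat hL hM ?_ w h
    rintro (p | p) - u hu
    · exact hu
    · exact ((u.2.1 s).neg_mem_iff (var p)).2 hu
  refine ⟨key φ, fun h => ?_⟩
  by_contra hn
  exact ((w.2.1 s).neg_mem_iff φ).1 (key _ (by rw [sat_neg]; exact hn)) h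

theorem logicEM_subset_valid : logicEM ⊆ {φ | ∀ V w, w ∈ sat (pairNhd L K) V φ} := by
  refine ext_subset (isLogic_valid _) (fun φ h => h _ (isLogic_valid _)) ?_
  rintro _ rfl V w
  exact (mem_sat_imp _ _).2 fun hw => pairNhd_mono w _ _ hw Set.subset_union_left

/-- The truth of a closed formula does not depend on the valuation, so a canonical one may be used.
-/
theorem valid_of_isClosed (hL : IsLogic L) (hM : logicEM ⊆ L) {φ : Formula} (hφ : φ.IsClosed)
    (hmem : φ ∈ L) (V : ℕ → Set (Pair L K)) (w : Pair L K) : w ∈ sat (pairNhd L K) V φ := by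
  rw [sat_congr (V' := pairVal L K true) pairNhd_mono
    (fun p hp => absurd (hφ.subset hp) (Set.notMem_empty p)), mem_sat_pairVal_iff hL hM]
  exact (w.2.1 true).subset hmem

/-- If `V p` lies within the pairs having `χ` in component `s`, positivity gives `α(χ)` there, and
the instance `α(χ) → ◇χ` yields exactly what a neighbourhood must satisfy. -/
theorem valid_imp_dia (hL : IsLogic L) (hM : logicEM ⊆ L) {p : ℕ} {α : Formula}
    (hpos : α.IsPositive) (hv : α.vars ⊆ {p}) (hmem : imp α (dia (var p)) ∈ L)
    (V : ℕ → Set (Pair L K)) (w : Pair L K) :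
    w ∈ sat (pairNhd L K) V (imp α (dia (var p))) := by
  refine (mem_sat_imp _ _).2 fun hw s χ hχ => ?_
  have h := hL.subst (fun _ => χ) _ hmem
  rw [imp_subst] at h
  refine (w.2.1 s).of_imp h (subst_mem_of_mem_sat hL hM (fun l hl u hu => ?_) w hw)
  obtain rfl := eq_pos_of_mem_lits hpos hv hl
  exact hχ u hu

end PairFrame

/-! ### Lyndon interpolation and positivity -/

section Main

variable {L : Set Formula}

theorem lip_of_valid (hL : IsLogic L) (hM : logicEM ⊆ L)
    (hval : ∀ K, ∀ φ ∈ L, ∀ V w, w ∈ sat (pairNhd L K) V φ) : LIP L := by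
  intro φ ψ h
  let K := φ.lits ∩ ψ.lits
  refine (exists_interpolant_or_pair (K := K) hL φ ψ).resolve_right ?_
  rintro ⟨w, hφ, hψ⟩
  -- The least valuation above the first canonical one on positive literals of `φ` and above the
  -- second on variables negated in `ψ`. Preservation of `K` gives the upper bounds, so literals of
  -- `φ` grow from the first to `V`, and those of `ψ` from `V` to the second.
  let V (p : ℕ) : Set (Pair L K) := {w | (.pos p ∈ φ.lits ∧ var p ∈ w.1 false) ∨
    (.neg p ∈ ψ.lits ∧ var p ∈ w.1 true)}
  have hmem (l : Literal) (h₁ : l ∈ φ.lits) (h₂ : l ∈ ψ.lits) (u : Pair L K)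
      (hu : lit l ∈ u.1 false) : lit l ∈ u.1 true :=
    u.2.2 _ (by rintro _ rfl; exact ⟨h₁, h₂⟩) hu
  have hφV : w ∈ sat (pairNhd L K) V φ := by
    refine sat_mono (V := pairVal L K false) pairNhd_mono ?_
      ((mem_sat_pairVal_iff hL hM false φ w).2 hφ)
    rintro (p | p) hp u hu
    · exact .inl ⟨hp, hu⟩
    · rintro (⟨-, hu'⟩ | ⟨hp', hu'⟩)
      · exact hu hu'
      · exact ((u.2.1 true).neg_mem_iff (var p)).1
          (hmem _ hp hp' u (((u.2.1 false).neg_mem_iff (var p)).2 hu)) hu'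
  refine hψ ((mem_sat_pairVal_iff hL hM true ψ w).1 (sat_mono (V := V) pairNhd_mono ?_
    ((mem_sat_imp _ _).1 (hval K _ h V w) hφV)))
  rintro (p | p) hp u hu
  · rcases hu with ⟨hp', hu⟩ | ⟨-, hu⟩
    · exact hmem _ hp' hp u hu
    · exact hu
  · exact fun hu' => hu (.inr ⟨hp, hu'⟩)

theorem lpp_of_valid (hL : IsLogic L) (hM : logicEM ⊆ L)
    (hval : ∀ K, ∀ φ ∈ L, ∀ V w, w ∈ sat (pairNhd L K) V φ) : LPP L := by
  rintro P R - φ hφ ⟨q, hq, hqPR, hmon⟩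
  -- With this `K`, an interpolant of `φ → φ` is the required positive equivalent.
  let K : Set Literal := {l | l.var ∈ P ∪ R ∧ ∀ p ∈ P, l ≠ .neg p}
  rcases exists_interpolant_or_pair (K := K) hL φ φ with ⟨α, hα, h₁, h₂⟩ | ⟨w, hw, hw'⟩
  · refine ⟨α, ?_, fun p hp h => (hα h).2 p hp rfl, hL.isTheory.iff_of_imp h₁ h₂⟩
    rintro _ ⟨l, hl, rfl⟩
    exact (hα hl).1
  exfalso
  have hmem (l : Literal) (h : l ∈ K) (u : Pair L K) (hu : lit l ∈ u.1 false) :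
      lit l ∈ u.1 true :=
    u.2.2 _ (by rintro _ rfl; exact h) hu
  have hpos (p : ℕ) (hp : p ∈ P ∪ R) : pairVal L K false p ⊆ pairVal L K true p :=
    fun u hu => hmem (.pos p) ⟨hp, by simp⟩ u hu
  have hneg (p : ℕ) (hp : p ∈ P ∪ R) (hp' : p ∉ P) :
      pairVal L K true p ⊆ pairVal L K false p := by
    intro u hu
    by_contra hn
    refine ((u.2.1 true).neg_mem_iff (var p)).1 (hmem (.neg p) ⟨hp, ?_⟩ u
      (((u.2.1 false).neg_mem_iff (var p)).2 hn)) hu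
    rintro r hr ⟨⟩
    exact hp' hr
  -- First canonical valuation on `P ∪ R`, second on the fresh `q p`. Then `p ∨ q p` gets the second
  -- valuation of `p`, as the first is contained in it; on `R` outside `P` both agree.
  let V (n : ℕ) : Set (Pair L K) :=
    {u | (n ∈ P ∪ R ∧ u ∈ pairVal L K false n) ∨ ∃ p ∈ P, q p = n ∧ u ∈ pairVal L K true p}
  have hV (p : ℕ) (hp : p ∈ P ∪ R) : V p = pairVal L K false p := by
    ext u
    refine ⟨?_, fun hu => .inl ⟨hp, hu⟩⟩
    rintro (⟨-, hu⟩ | ⟨r, hr, rfl, -⟩)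
    · exact hu
    · exact absurd hp (hqPR r hr)
  have hVq (p : ℕ) (hp : p ∈ P) : V (q p) = pairVal L K true p := by
    ext u
    refine ⟨?_, fun hu => .inr ⟨p, hp, rfl, hu⟩⟩
    rintro (⟨h, -⟩ | ⟨r, hr, hrp, hu⟩)
    · exact absurd h (hqPR p hp)
    · exact hq hr hp hrp ▸ hu
  have hsat : w ∈ sat (pairNhd L K) V φ := by
    rw [sat_congr (V' := pairVal L K false) pairNhd_mono fun p hp => hV p (hφ hp),
      mem_sat_pairVal_iff hL hM]
    exact hw
  have h := (mem_sat_imp _ _).1 (hval K _ hmon V w) hsat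
  rw [sat_subst, sat_congr (V' := pairVal L K true) pairNhd_mono, mem_sat_pairVal_iff hL hM] at h
  · exact hw' h
  · intro p hp
    have hp : p ∈ P ∪ R := hφ hp
    by_cases hpP : p ∈ P
    · simp only [joinSubst, hpP, if_true, sat, var, hV p hp, hVq p hpP]
      exact Set.union_eq_self_of_subset_left (hpos p hp)
    · simp only [joinSubst, hpP, if_false, sat, var, hV p hp]
      exact (hpos p hp).antisymm (hneg p hp hpP)

end Main

end MonModal

theorem mainTheorem4 (L Γ : Set MonModal.Formula)
    (hΓ : ∀ φ ∈ Γ, φ.IsClosed ∨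
      ∃ (p : ℕ) (α : MonModal.Formula), α.IsPositive ∧ α.vars ⊆ {p} ∧
        φ = MonModal.Formula.imp α (MonModal.Formula.dia (MonModal.Formula.var p)))
    (hL : L = MonModal.ext MonModal.logicEM Γ) :
    MonModal.LIP L ∧ MonModal.LPP L := by
  have hlogic : MonModal.IsLogic L := hL ▸ MonModal.isLogic_ext _ _
  have hM : MonModal.logicEM ⊆ L := hL ▸ MonModal.subset_ext_left _ _
  have hΓL : Γ ⊆ L := hL ▸ MonModal.subset_ext_right _ _
  have hval : ∀ K, L ⊆ {φ | ∀ V w, w ∈ MonModal.sat (MonModal.pairNhd L K) V φ} := by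
    intro K
    -- Only the logic being tested is unfolded; the frame is still built from `L`, whose theorems
    -- include `Γ`.
    nth_rw 1 [hL]
    refine MonModal.ext_subset (MonModal.isLogic_valid _) MonModal.logicEM_subset_valid ?_
    intro φ hφ V w
    rcases hΓ φ hφ with hc | ⟨p, α, hpos, hv, rfl⟩
    · exact MonModal.valid_of_isClosed hlogic hM hc (hΓL hφ) V w
    · exact MonModal.valid_imp_dia hlogic hM hpos hv (hΓL hφ) V w
  exact ⟨MonModal.lip_of_valid hlogic hM hval, MonModal.lpp_of_valid hlogic hM hval⟩
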